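/- Let $\mu,\nu$ be mutually absolutely continuous Borel probability measures on $\mathbb R$ such that $\log\frac{d\mu}{d\nu}$ is integrable under both, and such that $$I_1=\int\log\frac{d\mu}{d\nu}\,d\mu>0,\qquad I_0=-\int\log\frac{d\mu}{d\nu}\,d\nu>0;$$ put $I=\min\{I_0,I_1\}$. Let $s,c$ be nonnegative integers with $s>2c$. **Observations.** There is a binary state $\theta\in\{0,1\}$. The true observations $x_i(k)$ of the sensors $i\in\{1,\dots,s\}$ at the times $k=1,2,\dots$ are i.i.d. over $i$ and $k$, with law $\nu$ if $\theta=0$ and law $\mu$ if $\theta=1$. **Attacks.** An attack $g$ (with $c$ compromised sensors) adds a bias to the observations: the fusion center receives $x'(k)=x(k)+x^a(k)$. In state $\theta$, $x^a(k)$ vanishes outside a fixed set of exactly $c$ sensors and is a measurable function of $\theta$, $k$, the true observations of these sensors up to time $k$, the earlier biases, and the attacker's random draws up to time $k$, which are i.i.d. in time and independent of the true observations. Let $\mathbb P^g_\theta$ and $\mathbb E^g_\theta$ be the resulting probability and expectation. **Flip attack.** In the flip attack $g^*$ the compromised sensors are the first $c$ sensors if $\theta=0$ and the last $c$ sensors if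 $\theta=1$. For each compromised sensor $i$ and each time $k$, the attacker draws an independent $\tilde x_i(k)$ with law $\mu$ if $\theta=0$ and law $\nu$ if $\theta=1$, and injects $x^a_i(k)=\tilde x_i(k)-x_i(k)$. **Detection strategies.** A detection strategy consists of measurable maps $f_k$ ($k\ge 1$), each from $x'(1),\dots,x'(k)$ (and possibly private randomisation, independent of everything else) to $\{\text{continue},0,1\}$. Let $T$ be the first time at which $f_k$ is not "continue" ($T=\infty$ if there is none), and put $$\alpha=\mathbb P^g_0[T<\infty,\ f_T=1],\qquad \beta=\mathbb P^g_1[T<\infty,\ f_T=0],\qquad D=\max_{\theta\in\{0,1\}}\mathbb E^g_\theta[T].$$ **Performance.** For a family $f$ of detection strategies, indexed by tuning parameters (for example thresholds), the performance is $$\gamma(f,g)=\limsup_{\alpha=\beta\to0^+}\frac{\log(1/\alpha)}{D},$$ the upper limit being over those members of the family that satisfy $\alpha=\beta>0$, as this common value tends to $0$. It is the limit whenever the limit exists. If the family has no members with arbitrarily small $\alpha=\beta>0$, put $\gamma(f,g)=0$. **Theorem.** Under $g^*$, in either state $\theta$, the received observations $x'_i(k)$ are independent over $i$ and $k$; those of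 the first $c$ sensors have law $\mu$, those of the last $c$ sensors have law $\nu$, and those of the remaining $s-2c$ sensors have law $\nu$ if $\theta=0$ and law $\mu$ if $\theta=1$. Moreover, every family $f$ of detection strategies satisfies $$\gamma(f,g^*)\le (s-2c)\,I.$$ -/

import Mathlib

open MeasureTheory Filter Topology
open scoped ENNReal unitInterval

namespace ByzantineDetection

/-- Distribution of one honest observation when the binary state is `θ`
(`false` is state `0`, with law `ν`; `true` is state `1`, with law `μ`). -/
noncomputable def obsLaw (μ ν : Measure ℝ) : Bool → Measure ℝ
  | true => μ
  | false => ν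

instance (μ ν : Measure ℝ) [IsProbabilityMeasure μ] [IsProbabilityMeasure ν] (θ : Bool) :
    IsProbabilityMeasure (obsLaw μ ν θ) := by
  cases θ <;> (unfold obsLaw; infer_instance)

/-- The divergence `I₁ = ∫ log (dμ/dν) dμ`. -/
noncomputable def I₁ (μ ν : Measure ℝ) : ℝ := ∫ x, llr μ ν x ∂μ

/-- The divergence `I₀ = -∫ log (dμ/dν) dν`. -/
noncomputable def I₀ (μ ν : Measure ℝ) : ℝ := -∫ x, llr μ ν x ∂ν

/-! ### Attacks

Time is indexed by `ℕ`; the index `k` stands for the `(k+1)`-st time instant. -/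

/-- An admissible (possibly randomised) attack on exactly `c` of `s` sensors. In state `θ` the bias
at time `k` is a measurable function of the true observations of the compromised sensors up to
time `k`, of the biases before time `k`, and of the attacker's own random draws up to time `k`.
The draws are i.i.d. in time with a law `noise θ` chosen by the attacker, independent of the true
observations. The bias vanishes outside the compromised set. -/
structure Attack (s c : ℕ) where
  compromised : Bool → Finset (Fin s)
  card_compromised : ∀ θ, (compromised θ).card = c
  noise : Bool → ProbabilityMeasure (Fin s → ℝ)
  bias : ∀ (θ : Bool) (k : ℕ), (Fin (k + 1) → compromised θ → ℝ) → (Fin k → Fin s → ℝ) →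
    (Fin (k + 1) → Fin s → ℝ) → Fin s → ℝ
  measurable_bias : ∀ θ k, Measurable
    (fun p : (Fin (k + 1) → compromised θ → ℝ) × (Fin k → Fin s → ℝ) ×
      (Fin (k + 1) → Fin s → ℝ) => bias θ k p.1 p.2.1 p.2.2)
  bias_support : ∀ θ k x b w i, i ∉ compromised θ → bias θ k x b w i = 0

/-- The sequence of bias vectors produced by the attack `g` in state `θ`, from the true
observations `x` and the attacker's draws `w`. -/
noncomputable def Attack.biasSeq {s c : ℕ} (g : Attack s c) (θ : Bool)
    (x w : ℕ → Fin s → ℝ) (k : ℕ) : Fin s → ℝ :=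
  g.bias θ k (fun j i => x j i) (fun j : Fin k => g.biasSeq θ x w j) (fun j => w j)
termination_by k
decreasing_by exact j.isLt

/-- Outcomes: the true observations, the attacker's random draws, and the detector's own
randomisation. -/
abbrev Outcome (s : ℕ) : Type := (ℕ → Fin s → ℝ) × (ℕ → Fin s → ℝ) × (ℕ → I)

/-- The manipulated observations received by the fusion center. -/
noncomputable def received {s c : ℕ} (g : Attack s c) (θ : Bool) (ω : Outcome s) :
    ℕ → Fin s → ℝ :=
  fun k => ω.1 k + g.biasSeq θ ω.1 ω.2.1 k

/-- The probability measure in state `θ`: the true observations are i.i.d. over sensors and times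
with law `obsLaw μ ν θ`, and the attacker's draws and the detector's randomisation (uniform on
`[0,1]`) are i.i.d. over time; the three families are independent. -/
noncomputable def prob {s c : ℕ} (μ ν : Measure ℝ) [IsProbabilityMeasure μ]
    [IsProbabilityMeasure ν] (g : Attack s c) (θ : Bool) : Measure (Outcome s) :=
  (Measure.infinitePi fun _ : ℕ => Measure.pi fun _ : Fin s => obsLaw μ ν θ).prod
    ((Measure.infinitePi fun _ : ℕ => (g.noise θ : Measure (Fin s → ℝ))).prod
      (Measure.infinitePi fun _ : ℕ => (volume : Measure I)))

/-! ### Detection strategies -/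

/-- The possible outputs of a detector at one time instant. -/
inductive Decision
  | goOn
  | accept (θ : Bool)

/-- A detection strategy: at each time `k`, a measurable map from the observations received up to
time `k` (and from the detector's private uniform draws up to time `k`, which a deterministic
strategy ignores) to a decision. -/
structure Detector (s : ℕ) where
  rule : ∀ k : ℕ, (Fin (k + 1) → Fin s → ℝ) → (Fin (k + 1) → I) → Decision
  measurable_rule : ∀ k d, MeasurableSet
    {p : (Fin (k + 1) → Fin s → ℝ) × (Fin (k + 1) → I) | rule k p.1 p.2 = d}

/-- The output at time `k` on the received sequence `y` with private draws `u`. -/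
def Detector.output {s : ℕ} (f : Detector s) (y : ℕ → Fin s → ℝ) (u : ℕ → I) (k : ℕ) : Decision :=
  f.rule k (fun j => y j) (fun j => u j)

/-- The number of samples taken until the test terminates (`⊤` if it never does). -/
noncomputable def Detector.stopTime {s : ℕ} (f : Detector s) (y : ℕ → Fin s → ℝ) (u : ℕ → I) :
    ℕ∞ :=
  ⨅ (k : ℕ) (_ : f.output y u k ≠ .goOn), ((k + 1 : ℕ) : ℕ∞)

/-- The test terminates, and its terminal decision is `θ`. -/
def Detector.Decides {s : ℕ} (f : Detector s) (y : ℕ → Fin s → ℝ) (u : ℕ → I) (θ : Bool) : Prop :=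
  ∃ k, f.output y u k = .accept θ ∧ ∀ j < k, f.output y u j = .goOn

section Performance

variable {s c : ℕ} (μ ν : Measure ℝ) [IsProbabilityMeasure μ] [IsProbabilityMeasure ν]

/-- Type-I error probability `α` of `f` under the attack `g`. -/
noncomputable def typeI (f : Detector s) (g : Attack s c) : ℝ :=
  (prob μ ν g false).real {ω | f.Decides (received g false ω) ω.2.2 true}

/-- Type-II error probability `β` of `f` under the attack `g`. -/
noncomputable def typeII (f : Detector s) (g : Attack s c) : ℝ :=
  (prob μ ν g true).real {ω | f.Decides (received g true ω) ω.2.2 false}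

/-- Expected number of samples of `f` in state `θ` under the attack `g`. -/
noncomputable def expectedSamples (f : Detector s) (g : Attack s c) (θ : Bool) : ℝ≥0∞ :=
  ∫⁻ ω, (f.stopTime (received g θ ω) ω.2.2 : ℝ≥0∞) ∂(prob μ ν g θ)

/-- Worst case average sample number `D(T)`. -/
noncomputable def delay (f : Detector s) (g : Attack s c) : ℝ≥0∞ :=
  max (expectedSamples μ ν f g false) (expectedSamples μ ν f g true)

/-- For a detection strategy with tuning parameters `i : ι` (such as thresholds), the filter on
the parameters that describes the limit `α = β → 0⁺`. -/
noncomputable def errorFilter {ι : Type*} (f : ι → Detector s) (g : Attack s c) : Filter ι :=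
  comap (fun i => typeI μ ν (f i) g) (𝓝[>] 0) ⊓ 𝓟 {i | typeI μ ν (f i) g = typeII μ ν (f i) g}

/-- The performance `γ(f, g) = lim_{α = β → 0⁺} log (1/α) / D(T)` of a tunable detection strategy
under the attack `g`. It is taken as an upper limit, which is the limit whenever that exists. -/
noncomputable def performance {ι : Type*} (f : ι → Detector s) (g : Attack s c) : ℝ≥0∞ :=
  limsup (fun i => ENNReal.ofReal (Real.log (1 / typeI μ ν (f i) g)) / delay μ ν (f i) g)
    (errorFilter μ ν f g)

theorem performance_eq_of_tendsto {ι : Type*} (f : ι → Detector s) (g : Attack s c)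
    [(errorFilter μ ν f g).NeBot] {L : ℝ≥0∞}
    (h : Tendsto (fun i => ENNReal.ofReal (Real.log (1 / typeI μ ν (f i) g)) / delay μ ν (f i) g)
      (errorFilter μ ν f g) (𝓝 L)) : performance μ ν f g = L :=
  h.limsup_eq

end Performance

/-! ### The flip attack -/

/-- The sensors compromised by the flip attack: the first `c` sensors in state `0`, the last `c`
sensors in state `1`. -/
def flipSet (s c : ℕ) : Bool → Finset (Fin s)
  | false => Finset.univ.filter fun i => (i : ℕ) < c
  | true => Finset.univ.filter fun i => s ≤ (i : ℕ) + c

theorem card_flipSet {s c : ℕ} (h : 2 * c < s) (θ : Bool) : (flipSet s c θ).card = c := by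
  cases θ
  · simp only [flipSet]
    rw [Fin.card_filter_val_lt]
    omega
  · simp only [flipSet]
    have h1 : (Finset.univ.filter fun i : Fin s => s ≤ (i : ℕ) + c)
        = (Finset.univ.filter fun i : Fin s => (i : ℕ) < s - c)ᶜ := by
      ext i
      simp only [Finset.mem_filter, Finset.mem_univ, true_and, Finset.mem_compl]
      omega
    rw [h1, Finset.card_compl, Fin.card_filter_val_lt, Fintype.card_fin]
    omega

/-- The flip attack `g*`: fresh independent observations `x̃` are drawn from the opposite law, and
the bias `x̃ - x` is injected at each compromised sensor. -/
noncomputable def flipAttack {s c : ℕ} (h : 2 * c < s) (μ ν : Measure ℝ) [IsProbabilityMeasure μ]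
    [IsProbabilityMeasure ν] : Attack s c where
  compromised := flipSet s c
  card_compromised := card_flipSet h
  noise θ := ⟨Measure.pi fun _ => obsLaw μ ν (!θ), inferInstance⟩
  bias θ k x _ w i := if hi : i ∈ flipSet s c θ then w (Fin.last k) i - x (Fin.last k) ⟨i, hi⟩ else 0
  measurable_bias θ k := by
    refine measurable_pi_lambda _ fun i => ?_
    by_cases hi : i ∈ flipSet s c θ
    · simp only [hi, dite_true]
      fun_prop
    · simp only [hi, dite_false]
      exact measurable_const
  bias_support θ k x b w i hi := by simp [hi]

/-- The law of sensor `i` announced for the received data under the flip attack: `μ` for the first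
`c` sensors, `ν` for the last `c` sensors, the honest law for the others. -/
noncomputable def flippedLaw {s : ℕ} (c : ℕ) (μ ν : Measure ℝ) (θ : Bool) (i : Fin s) : Measure ℝ :=
  if (i : ℕ) < c then μ else if s ≤ (i : ℕ) + c then ν else obsLaw μ ν θ

instance {s : ℕ} (c : ℕ) (μ ν : Measure ℝ) [IsProbabilityMeasure μ] [IsProbabilityMeasure ν]
    (θ : Bool) (i : Fin s) : IsProbabilityMeasure (flippedLaw c μ ν θ i) := by
  unfold flippedLaw
  split_ifs <;> infer_instance

end ByzantineDetection

open ByzantineDetection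

open ProbabilityTheory

namespace ByzantineDetection

/-! Under the flip attack the first and last `c` sensors have the same received laws in both states,
so only the `s - 2c` middle sensors carry information. The fusion center thus tests two simple
hypotheses on i.i.d. vectors, and the divergence per vector, from state `θ` to the other state, is
`(s - 2c)` times `I₀` or `I₁`.

For such a test Wald's lower bound applies. Let `S` be the log-likelihood ratio of the true state
`P` against the other state `Q`. Wald's identity (`StoppingSets.integral_eq`) gives the mean of `S`
at the truncated stopping time as divergence times mean sample number. In the other direction, `log
a + 1 - a * exp (-S) ≤ S`, integrated over the stopping events with suitable constants `a`
(`sub_le_setIntegral_of_density`), bounds that mean below through the error probabilities. Removing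
the truncation gives `log (1/ε) ≤ K * D + o(1)` (`StoppingSets.log_le_mul`). As `D` is the maximum
over both states, the smaller divergence bounds the performance. -/

/-! ### Product measures -/

section Product

variable {κ X Ξ : Type*} [MeasurableSpace X] [MeasurableSpace Ξ]

/-- Multiplying an infinite product of probability measures by a finite product of densities
changes only the corresponding factors. -/
theorem withDensity_infinitePi (P Q : κ → Measure X) [∀ k, IsProbabilityMeasure (P k)]
    [∀ k, IsProbabilityMeasure (Q k)] (r : Finset κ) (f : κ → X → ℝ≥0∞)
    (hf : ∀ k, Measurable (f k)) (hQ : ∀ k ∈ r, Q k = (P k).withDensity (f k))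
    (hQ' : ∀ k ∉ r, Q k = P k) :
    (Measure.infinitePi P).withDensity (fun x => ∏ k ∈ r, f k (x k)) = Measure.infinitePi Q := by
  classical
  refine Measure.eq_infinitePi _ fun s t ht => ?_
  have hs : MeasurableSet ((s : Set κ).pi t) := .pi s.countable_toSet fun i _ => ht i
  -- The density times the indicator of a box is a product of one-coordinate functions over `s ∪ r`;
  -- independence then evaluates its integral factor by factor.
  let g : κ → X → ℝ≥0∞ := fun k y =>
    (if k ∈ s then (t k).indicator 1 y else 1) * (if k ∈ r then f k y else 1)
  have hg : ∀ k, Measurable (g k) := fun k => by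
    refine Measurable.mul ?_ ?_
    · split_ifs
      · exact measurable_one.indicator (ht k)
      · exact measurable_const
    · split_ifs
      · exact hf k
      · exact measurable_const
  have hgint : ∀ k, ∫⁻ y, g k y ∂(P k) = if k ∈ s then Q k (t k) else 1 := fun k => by
    have hdens : ∀ h : X → ℝ≥0∞, Measurable h →
        ∫⁻ y, h y * (if k ∈ r then f k y else 1) ∂(P k) = ∫⁻ y, h y ∂(Q k) := fun h hh => by
      by_cases hk : k ∈ r
      · rw [hQ k hk, lintegral_withDensity_eq_lintegral_mul _ (hf k) hh]
        simp [hk, mul_comm]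
      · simp [hk, hQ' k hk]
    by_cases hk : k ∈ s
    · simp only [g, hk, if_true]
      rw [hdens _ (measurable_one.indicator (ht k)), lintegral_indicator_one (ht k)]
    · simp only [g, hk, if_false]
      rw [hdens _ measurable_const]
      simp
  rw [withDensity_apply _ hs, ← lintegral_indicator hs]
  have hind : ((s : Set κ).pi t).indicator (fun x => ∏ k ∈ r, f k (x k))
      = fun x : κ → X => ∏ k ∈ s ∪ r, g k (x k) := by
    ext x
    simp only [g, Finset.prod_mul_distrib, Finset.prod_ite_mem, Finset.union_inter_cancel_left,
      Finset.union_inter_cancel_right]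
    by_cases hx : x ∈ (s : Set κ).pi t
    · rw [Set.indicator_of_mem hx, Finset.prod_eq_one fun k hk => Set.indicator_of_mem (hx k hk) _,
        one_mul]
    · rw [Set.indicator_of_notMem hx]
      obtain ⟨k, hk, hxk⟩ : ∃ k ∈ s, x k ∉ t k := by
        simpa [Set.mem_pi] using hx
      rw [Finset.prod_eq_zero hk (Set.indicator_of_notMem hxk _), zero_mul]
  have hprod := lintegral_prod_eq_prod_lintegral_of_indepFun (s ∪ r) (fun k (x : κ → X) => g k (x k))
    (iIndepFun_infinitePi (P := P) hg) fun k => (hg k).comp (measurable_pi_apply k)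
  rw [hind]
  refine hprod.trans ?_
  have heval : ∀ k, ∫⁻ x, g k (x k) ∂(Measure.infinitePi P) = ∫⁻ y, g k y ∂(P k) := fun k => by
    rw [← Measure.infinitePi_map_eval P k, lintegral_map (hg k) (measurable_pi_apply k)]
  simp only [heval, hgint, Finset.prod_ite_mem, Finset.union_inter_cancel_left]

/-- Choosing each coordinate from one of two independent product samples gives a product sample. -/
theorem map_infinitePi_prod_infinitePi_select (a b : κ → Measure X)
    [∀ k, IsProbabilityMeasure (a k)] [∀ k, IsProbabilityMeasure (b k)] (S : κ → Prop)
    [DecidablePred S] [Countable κ] :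
    ((Measure.infinitePi a).prod (Measure.infinitePi b)).map
        (fun z k => if S k then z.2 k else z.1 k)
      = Measure.infinitePi fun k => if S k then b k else a k := by
  classical
  have : ∀ k, IsProbabilityMeasure (if S k then b k else a k) := fun k => by
    split_ifs <;> infer_instance
  refine Measure.eq_infinitePi _ fun s t ht => ?_
  have hmeas : Measurable fun (z : (κ → X) × (κ → X)) k => if S k then z.2 k else z.1 k := by
    refine measurable_pi_lambda _ fun k => ?_
    split_ifs <;> fun_prop
  have hpre : (fun (z : (κ → X) × (κ → X)) k => if S k then z.2 k else z.1 k) ⁻¹'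
      ((s : Set κ).pi t) = ((s.filter fun k => ¬ S k : Finset κ) : Set κ).pi t ×ˢ
        ((s.filter S : Finset κ) : Set κ).pi t := by
    ext z
    simp only [Set.mem_preimage, Set.mem_pi, Set.mem_prod, Finset.coe_filter, Set.mem_ofPred_eq,
      Finset.mem_coe]
    constructor
    · intro h
      exact ⟨fun k hk => by simpa [hk.2] using h k hk.1, fun k hk => by simpa [hk.2] using h k hk.1⟩
    · intro h k hk
      by_cases hS : S k
      · simpa [hS] using h.2 k ⟨hk, hS⟩
      · simpa [hS] using h.1 k ⟨hk, hS⟩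
  rw [Measure.map_apply hmeas (.pi s.countable_toSet fun i _ => ht i), hpre, Measure.prod_prod,
    Measure.infinitePi_pi _ fun i _ => ht i, Measure.infinitePi_pi _ fun i _ => ht i,
    ← Finset.prod_filter_mul_prod_filter_not s S, mul_comm]
  congr 1
  · exact Finset.prod_congr rfl fun k hk => by simp [(Finset.mem_filter.1 hk).2]
  · exact Finset.prod_congr rfl fun k hk => by simp [(Finset.mem_filter.1 hk).2]

/-- Flattening time and sensor into one index reduces selection in sequences of vectors to selection
in a single product. -/
theorem infinitePi_pi_eq_map_curry {T J : Type*} [Fintype J] (a : J → Measure X)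
    [∀ k, IsProbabilityMeasure (a k)] :
    (Measure.infinitePi fun _ : T => Measure.pi a)
      = (Measure.infinitePi fun p : T × J => a p.2).map Function.curry := by
  rw [← MeasurableEquiv.coe_curry, Measure.infinitePi_map_curry (fun (_ : T) (j : J) => a j)]
  simp only [Measure.infinitePi_eq_pi]

/-- Choosing each coordinate of each member of a sequence from one of two independent i.i.d.
sequences of vectors with independent coordinates. -/
theorem map_infinitePi_pi_prod_select {T J : Type*} [Countable T] [Fintype J] (a b : J → Measure X)
    [∀ k, IsProbabilityMeasure (a k)] [∀ k, IsProbabilityMeasure (b k)] (S : J → Prop)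
    [DecidablePred S] :
    ((Measure.infinitePi fun _ : T => Measure.pi a).prod
        (Measure.infinitePi fun _ : T => Measure.pi b)).map
        (fun z k i => if S i then z.2 k i else z.1 k i)
      = Measure.infinitePi fun _ : T => Measure.pi fun i => if S i then b i else a i := by
  have : ∀ k, IsProbabilityMeasure (if S k then b k else a k) := fun k => by
    split_ifs <;> infer_instance
  have hcurry : Measurable (Function.curry : (T × J → X) → T → J → X) :=
    (MeasurableEquiv.curry T J X).measurable
  have hsel : ∀ (κ : Type _) (S : κ → Prop) [DecidablePred S], Measurable
      fun (z : (κ → X) × (κ → X)) k => if S k then z.2 k else z.1 k := by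
    intro κ S _
    refine measurable_pi_lambda _ fun k => ?_
    split_ifs <;> fun_prop
  have hsel' : Measurable fun (z : (T → J → X) × (T → J → X)) k i =>
      if S i then z.2 k i else z.1 k i := by
    refine measurable_pi_lambda _ fun k => measurable_pi_lambda _ fun i => ?_
    split_ifs <;> fun_prop
  rw [infinitePi_pi_eq_map_curry, infinitePi_pi_eq_map_curry, infinitePi_pi_eq_map_curry,
    Measure.map_prod_map _ _ hcurry hcurry, Measure.map_map hsel' (hcurry.prodMap hcurry),
    ← map_infinitePi_prod_infinitePi_select (fun p : T × J => a p.2) (fun p => b p.2)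
      (fun p => S p.2), Measure.map_map hcurry (hsel _ _)]
  rfl

/-- Adjoining an independent variable to one of two independent variables keeps independence. -/
theorem IndepFun.prodMk_snd {Ω β γ : Type*} [MeasurableSpace Ω] [MeasurableSpace β]
    [MeasurableSpace γ] {P : Measure Ω} [IsProbabilityMeasure P] {U : Measure Ξ}
    [IsProbabilityMeasure U] {f : Ω → β} {h : Ω → γ} (hf : Measurable f) (hh : Measurable h)
    (hfh : IndepFun f h P) :
    IndepFun (fun z : Ω × Ξ => (f z.1, z.2)) (fun z => h z.1) (P.prod U) := by
  rw [indepFun_iff_measure_inter_preimage_eq_mul] at hfh ⊢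
  intro C D hC hD
  have hm : Measurable fun z : Ω × Ξ => (f z.1, z.2) := by fun_prop
  have hD' : (P.prod U) ((fun z : Ω × Ξ => h z.1) ⁻¹' D) = P (h ⁻¹' D) := by
    have : (fun z : Ω × Ξ => h z.1) ⁻¹' D = (h ⁻¹' D) ×ˢ Set.univ := by ext; simp
    rw [this, Measure.prod_prod, measure_univ, mul_one]
  have hCD : MeasurableSet
      ((fun z : Ω × Ξ => (f z.1, z.2)) ⁻¹' C ∩ (fun z : Ω × Ξ => h z.1) ⁻¹' D) :=
    (hm hC).inter (hh.comp measurable_fst hD)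
  -- Fubini along the adjoined variable: for each fixed `u`, independence of `f` and `h` splits the
  -- section.
  rw [hD', Measure.prod_apply_symm (hm hC),
    Measure.prod_apply_symm hCD, ← lintegral_mul_const]
  · refine lintegral_congr fun u => ?_
    exact hfh {y | (y, u) ∈ C} D (measurable_prodMk_right hC) hD
  · exact measurable_measure_prodMk_right (hm hC)

end Product

/-! ### A sequential change of measure inequality -/

section Sequential

variable {Ω : Type*} {m : MeasurableSpace Ω}

/-- The tangent line bound for the logarithm, integrated against a change of measure. -/
theorem sub_le_setIntegral_of_density {P Q : Measure Ω} [IsProbabilityMeasure P]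
    [IsProbabilityMeasure Q] {S : Ω → ℝ} (hS : Measurable S) (hSint : Integrable S P) {C : Set Ω}
    (hPQ : Q C = ∫⁻ ω in C, ENNReal.ofReal (Real.exp (-S ω)) ∂P)
    {a : ℝ} (ha : 0 < a) :
    P.real C * (Real.log a + 1) - a * Q.real C ≤ ∫ ω in C, S ω ∂P := by
  have hexp : Integrable (fun ω => Real.exp (-S ω)) (P.restrict C) := by
    refine ⟨by fun_prop, ?_⟩
    rw [hasFiniteIntegral_iff_ofReal (ae_of_all _ fun ω => (Real.exp_pos _).le), ← hPQ]
    exact measure_lt_top Q C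
  have hQ : Q.real C = ∫ ω in C, Real.exp (-S ω) ∂P := by
    rw [integral_eq_lintegral_of_nonneg_ae (ae_of_all _ fun ω => (Real.exp_pos _).le)
      hexp.aestronglyMeasurable, ← hPQ]
    rfl
  have hconst : P.real C * (Real.log a + 1) = ∫ _ in C, (Real.log a + 1) ∂P := by
    simp [mul_comm]
  rw [hQ, hconst, ← integral_const_mul, ← integral_sub (integrable_const _) (hexp.const_mul a)]
  refine integral_mono ((integrable_const _).sub (hexp.const_mul a)) hSint.integrableOn fun ω => ?_
  -- Equality holds where `S = log a`. Optimising over `a` would give the log-sum inequality; a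
  -- fixed `a` keeps the bound linear in `P C` and `Q C`, hence summable over stopping times.
  have h := Real.add_one_le_exp (Real.log a - S ω)
  rw [sub_eq_add_neg, Real.exp_add, Real.exp_log ha] at h
  simp only
  linarith

/-- A sequential test, described by the events `A k` and `B k` of stopping after `k + 1` samples
with either decision and the events `G k` of taking more than `k` samples. -/
structure StoppingSets (F : ℕ → MeasurableSpace Ω) (A B G : ℕ → Set Ω) : Prop where
  measurable_left : ∀ k, MeasurableSet[F (k + 1)] (A k)
  measurable_right : ∀ k, MeasurableSet[F (k + 1)] (B k)
  measurable_goOn : ∀ k, MeasurableSet[F k] (G k)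
  zero : G 0 = Set.univ
  eq_union : ∀ k, G k = (A k ∪ B k) ∪ G (k + 1)
  disjoint_left_right : ∀ k, Disjoint (A k) (B k)
  disjoint_goOn : ∀ k, Disjoint (A k ∪ B k) (G (k + 1))

variable {F : ℕ → MeasurableSpace Ω} {A B G : ℕ → Set Ω} {P Q : Measure Ω}

theorem StoppingSets.measureReal_goOn (h : StoppingSets F A B G) (hF : ∀ n, F n ≤ m)
    (R : Measure Ω) [IsProbabilityMeasure R] (n : ℕ) :
    (∑ k ∈ Finset.range n, R.real (A k)) + (∑ k ∈ Finset.range n, R.real (B k)) + R.real (G n)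
      = 1 := by
  induction n with
  | zero => simp [h.zero]
  | succ n ih =>
    rw [h.eq_union n, measureReal_union (h.disjoint_goOn n) (hF _ _ (h.measurable_goOn (n + 1))),
      measureReal_union (h.disjoint_left_right n) (hF _ _ (h.measurable_right n))] at ih
    rw [Finset.sum_range_succ, Finset.sum_range_succ]
    linarith

/-- `G` decreases, and stopping at index `k` happens inside `G k` but outside `G (k + 1)`. -/
theorem StoppingSets.pairwise_disjoint (h : StoppingSets F A B G) :
    Pairwise (Function.onFun Disjoint fun k => A k ∪ B k) := by
  have hanti : ∀ j k, j ≤ k → G k ⊆ G j := by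
    intro j k hjk
    induction hjk with
    | refl => exact subset_rfl
    | step _ ih => exact (((h.eq_union _).symm ▸ Set.subset_union_right)).trans ih
  have hlt : ∀ j k, j < k → Disjoint (A j ∪ B j) (A k ∪ B k) := fun j k hjk =>
    (h.disjoint_goOn j).mono_right
      (((h.eq_union k).symm ▸ Set.subset_union_left).trans (hanti (j + 1) k hjk))
  intro j k hjk
  rcases lt_or_gt_of_ne hjk with h' | h'
  · exact hlt j k h'
  · exact (hlt k j h').symm

theorem StoppingSets.sum_left_le (h : StoppingSets F A B G) (hF : ∀ n, F n ≤ m)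
    (R : Measure Ω) [IsProbabilityMeasure R] (n : ℕ) :
    ∑ k ∈ Finset.range n, R.real (A k) ≤ R.real (⋃ k, A k) := by
  rw [← measureReal_biUnion_finset
    (fun j _ k _ hjk => (h.pairwise_disjoint hjk).mono Set.subset_union_left Set.subset_union_left)
    fun k _ => hF _ _ (h.measurable_left k)]
  exact measureReal_mono (Set.iUnion₂_subset fun k _ => Set.subset_iUnion A k)

theorem StoppingSets.symm (h : StoppingSets F A B G) : StoppingSets F B A G where
  measurable_left := h.measurable_right
  measurable_right := h.measurable_left
  measurable_goOn := h.measurable_goOn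
  zero := h.zero
  eq_union k := Set.union_comm (A k) (B k) ▸ h.eq_union k
  disjoint_left_right k := (h.disjoint_left_right k).symm
  disjoint_goOn k := Set.union_comm (A k) (B k) ▸ h.disjoint_goOn k

/-- Wald's identity for a test truncated at time `n`. -/
theorem StoppingSets.integral_eq (h : StoppingSets F A B G) (hF : ∀ n, F n ≤ m)
    {ℓ : ℕ → Ω → ℝ} {K : ℝ} (hint : ∀ k, Integrable (ℓ k) P)
    (hind : ∀ k C, MeasurableSet[F k] C → ∫ ω in C, ℓ k ω ∂P = K * P.real C) (n : ℕ) :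
    (∑ k ∈ Finset.range n, ((∫ ω in A k, ∑ j ∈ Finset.range (k + 1), ℓ j ω ∂P)
        + ∫ ω in B k, ∑ j ∈ Finset.range (k + 1), ℓ j ω ∂P))
      + ∫ ω in G n, ∑ j ∈ Finset.range n, ℓ j ω ∂P
      = K * ∑ k ∈ Finset.range n, P.real (G k) := by
  have hS : ∀ n, Integrable (fun ω => ∑ j ∈ Finset.range n, ℓ j ω) P := fun n =>
    integrable_finsetSum _ fun j _ => hint j
  induction n with
  | zero => simp
  | succ n ih =>
    -- `G n` is decided before increment `n` is seen, so this increment contributes its mean `K` on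
    -- `G n`.
    have hstep : ∫ ω in G n, ∑ j ∈ Finset.range (n + 1), ℓ j ω ∂P
        = (∫ ω in G n, ∑ j ∈ Finset.range n, ℓ j ω ∂P) + K * P.real (G n) := by
      simp only [Finset.sum_range_succ]
      rw [integral_add (hS n).integrableOn (hint n).integrableOn, hind n _ (h.measurable_goOn n)]
    have hsplit : ∫ ω in G n, ∑ j ∈ Finset.range (n + 1), ℓ j ω ∂P
        = (∫ ω in A n, ∑ j ∈ Finset.range (n + 1), ℓ j ω ∂P)
          + (∫ ω in B n, ∑ j ∈ Finset.range (n + 1), ℓ j ω ∂P)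
          + ∫ ω in G (n + 1), ∑ j ∈ Finset.range (n + 1), ℓ j ω ∂P := by
      rw [h.eq_union n, setIntegral_union (h.disjoint_goOn n) (hF _ _ (h.measurable_goOn (n + 1)))
        (hS _).integrableOn (hS _).integrableOn, setIntegral_union (h.disjoint_left_right n)
        (hF _ _ (h.measurable_right n)) (hS _).integrableOn (hS _).integrableOn]
    rw [Finset.sum_range_succ, Finset.sum_range_succ (fun k => P.real (G k))]
    linarith

/-- A sequential test with error probabilities `ε` under both hypotheses takes, on average, at
least about `log (1 / ε) / K` samples, where `K` is the mean of the log-likelihood increments. -/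
theorem StoppingSets.log_le_mul [IsProbabilityMeasure P] [IsProbabilityMeasure Q]
    (h : StoppingSets F A B G) (hF : ∀ n, F n ≤ m)
    {ℓ : ℕ → Ω → ℝ} {K : ℝ} (hK : 0 ≤ K) (hmeas : ∀ k, Measurable (ℓ k))
    (hint : ∀ k, Integrable (ℓ k) P)
    (hind : ∀ k C, MeasurableSet[F k] C → ∫ ω in C, ℓ k ω ∂P = K * P.real C)
    (hPQ : ∀ n C, MeasurableSet[F n] C →
      Q C = ∫⁻ ω in C, ENNReal.ofReal (Real.exp (-∑ j ∈ Finset.range n, ℓ j ω)) ∂P)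
    {ε D : ℝ} (hε : 0 < ε) (hε1 : ε ≤ 1) (hB : P.real (⋃ k, B k) ≤ ε) (hA : Q.real (⋃ k, A k) ≤ ε)
    (hD : ∀ n, ∑ k ∈ Finset.range n, P.real (G k) ≤ D) :
    Real.log (1 / ε) ≤ K * D + (2 * ε * Real.log (1 / ε) + 3 * ε) := by
  set L := Real.log (1 / ε) with hL
  have hL0 : 0 ≤ L := Real.log_nonneg (by rw [le_div_iff₀ hε]; linarith)
  have hlogε : Real.log ε = -L := by rw [hL, one_div, Real.log_inv, neg_neg]
  have hS : ∀ n, Measurable fun ω => ∑ j ∈ Finset.range n, ℓ j ω := fun n =>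
    Finset.measurable_sum _ fun j _ => hmeas j
  have hSint : ∀ n, Integrable (fun ω => ∑ j ∈ Finset.range n, ℓ j ω) P := fun n =>
    integrable_finsetSum _ fun j _ => hint j
  have hbound : ∀ n, L ≤ K * D + (2 * ε * L + 3 * ε) + P.real (G n) * (2 * L + 1) := by
    intro n
    -- The constant is `a = 1 / ε` on the correct decisions `A`, whose total `Q`-mass is at most
    -- `ε`. On `B` and `G n` it is `a = ε`, which makes the `Q`-terms negligible whatever their
    -- mass.
    have h1 : ∀ k, P.real (A k) * (L + 1) - 1 / ε * Q.real (A k)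
        ≤ ∫ ω in A k, ∑ j ∈ Finset.range (k + 1), ℓ j ω ∂P := fun k =>
      sub_le_setIntegral_of_density (hS _) (hSint _)
        (hPQ _ _ (h.measurable_left k)) (one_div_pos.2 hε)
    have h2 : ∀ k, P.real (B k) * (-L + 1) - ε * Q.real (B k)
        ≤ ∫ ω in B k, ∑ j ∈ Finset.range (k + 1), ℓ j ω ∂P := fun k => hlogε ▸
      sub_le_setIntegral_of_density (hS _) (hSint _)
        (hPQ _ _ (h.measurable_right k)) hε
    have h3 : P.real (G n) * (-L + 1) - ε * Q.real (G n)
        ≤ ∫ ω in G n, ∑ j ∈ Finset.range n, ℓ j ω ∂P := hlogε ▸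
      sub_le_setIntegral_of_density (hS _) (hSint _)
        (hPQ _ _ (h.measurable_goOn n)) hε
    have h4 := Finset.sum_le_sum fun k (_ : k ∈ Finset.range n) => add_le_add (h1 k) (h2 k)
    have h5 := h.integral_eq hF hint hind n
    simp only [Finset.sum_add_distrib, Finset.sum_sub_distrib, ← Finset.sum_mul,
      ← Finset.mul_sum] at h4
    simp only [Finset.sum_add_distrib] at h5
    have hP1 := h.measureReal_goOn hF P n
    have hQ1 := h.measureReal_goOn hF Q n
    have hPB := (h.symm.sum_left_le hF P n).trans hB
    have hQA := (h.sum_left_le hF Q n).trans hA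
    have hKD := mul_le_mul_of_nonneg_left (hD n) hK
    have hPB0 : 0 ≤ ∑ k ∈ Finset.range n, P.real (B k) :=
      Finset.sum_nonneg fun _ _ => measureReal_nonneg
    have hQA0 : 0 ≤ ∑ k ∈ Finset.range n, Q.real (A k) :=
      Finset.sum_nonneg fun _ _ => measureReal_nonneg
    have hPG0 : 0 ≤ P.real (G n) := measureReal_nonneg
    generalize ∑ k ∈ Finset.range n, P.real (A k) = pa at *
    generalize ∑ k ∈ Finset.range n, P.real (B k) = pb at *
    generalize ∑ k ∈ Finset.range n, Q.real (A k) = qa at *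
    generalize ∑ k ∈ Finset.range n, Q.real (B k) = qb at *
    generalize P.real (G n) = pg at *
    generalize Q.real (G n) = qg at *
    have hqa : 1 / ε * qa ≤ 1 := by
      rw [one_div, inv_mul_le_iff₀ hε]; linarith
    have hq : ε * (qb + qg) ≤ ε := mul_le_of_le_one_right hε.le (by linarith)
    -- The tangent bounds contribute `1` in total, which absorbs `qa / ε ≤ 1`. Replacing `pa` costs
    -- `2 * L` per unit of `pb` and of `pg`; `pb ≤ ε` gives the term `2 * ε * L`.
    obtain rfl : pa = 1 - pb - pg := by linarith
    have := mul_le_mul_of_nonneg_right hPB hL0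
    nlinarith [mul_nonneg hPG0 hL0]
  -- The tail probabilities have partial sums bounded by `D`, so they tend to zero and the
  -- truncation disappears.
  have hlim : Tendsto (fun n => K * D + (2 * ε * L + 3 * ε) + P.real (G n) * (2 * L + 1)) atTop
      (𝓝 (K * D + (2 * ε * L + 3 * ε) + 0 * (2 * L + 1))) :=
    ((summable_of_sum_range_le (fun _ => measureReal_nonneg) hD).tendsto_atTop_zero.mul_const
      _).const_add _
  simpa using ge_of_tendsto' hlim hbound

end Sequential


/-! ### I.i.d. samples with private randomisation -/

section Samples

variable {X Ξ : Type*} [MeasurableSpace X] [MeasurableSpace Ξ]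

/-- The first `n` samples, together with the private randomisation. -/
abbrev history (X Ξ : Type*) [MeasurableSpace X] [MeasurableSpace Ξ] (n : ℕ) :
    MeasurableSpace ((ℕ → X) × Ξ) :=
  MeasurableSpace.comap (fun z => ((Finset.range n).restrict z.1, z.2)) inferInstance

theorem measurable_restrict_prodMk (n : ℕ) : Measurable fun z : (ℕ → X) × Ξ =>
    ((Finset.range n).restrict (π := fun _ => X) z.1, z.2) :=
  ((Finset.measurable_restrict _).comp measurable_fst).prodMk measurable_snd

theorem history_le (n : ℕ) : history X Ξ n ≤ Prod.instMeasurableSpace :=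
  (measurable_restrict_prodMk n).comap_le

theorem measurable_history_snd (n : ℕ) :
    Measurable[history X Ξ n] (Prod.snd : (ℕ → X) × Ξ → Ξ) :=
  (comap_measurable
    fun z : (ℕ → X) × Ξ => ((Finset.range n).restrict (π := fun _ => X) z.1, z.2)).snd

theorem measurable_history_apply {j n : ℕ} (h : j < n) :
    Measurable[history X Ξ n] fun z : (ℕ → X) × Ξ => z.1 j :=
  ((measurable_pi_apply (⟨j, Finset.mem_range.2 h⟩ : Finset.range n)).comp measurable_fst).comp
    (comap_measurable fun z : (ℕ → X) × Ξ => ((Finset.range n).restrict (π := fun _ => X) z.1, z.2))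

/-- The law of infinitely many i.i.d. samples and of an independent randomisation. -/
noncomputable def sampleLaw (P : Measure X) (U : Measure Ξ) : Measure ((ℕ → X) × Ξ) :=
  (Measure.infinitePi fun _ => P).prod U

variable (P Q : Measure X) [IsProbabilityMeasure P] [IsProbabilityMeasure Q] (U : Measure Ξ)
  [IsProbabilityMeasure U]

instance : IsProbabilityMeasure (sampleLaw P U) := by
  unfold sampleLaw; infer_instance

theorem measurePreserving_sampleLaw (n : ℕ) :
    MeasurePreserving (fun z : (ℕ → X) × Ξ => z.1 n) (sampleLaw P U) P :=
  (measurePreserving_eval_infinitePi (fun _ : ℕ => P) n).comp measurePreserving_fst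

variable {P Q}

theorem setIntegral_sampleLaw {φ : X → ℝ} (hφ : Measurable φ) {n : ℕ} {C : Set ((ℕ → X) × Ξ)}
    (hC : MeasurableSet[history X Ξ n] C) :
    ∫ z in C, φ (z.1 n) ∂(sampleLaw P U) = (∫ x, φ x ∂P) * (sampleLaw P U).real C := by
  have hcoord : iIndepFun (fun k (x : ℕ → X) => x k) (Measure.infinitePi fun _ => P) :=
    iIndepFun_infinitePi (X := fun _ x => x) fun _ => measurable_id
  have hpair := hcoord.indepFun_finset (Finset.range n) {n} (by simp) fun k => measurable_pi_apply k
  have hind : IndepFun (fun x : ℕ → X => (Finset.range n).restrict x) (fun x => x n)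
      (Measure.infinitePi fun _ => P) :=
    hpair.comp measurable_id (measurable_pi_apply (⟨n, by simp⟩ : ({n} : Finset ℕ)))
  -- Every history contains the whole randomisation, future draws included; these are independent of
  -- the samples, so sample `n` remains independent of the past.
  have hind' : Indep (history X Ξ n) (MeasurableSpace.comap (fun z => z.1 n) inferInstance)
      (sampleLaw P U) :=
    (IndepFun_iff_Indep _ _ _).1 (IndepFun.prodMk_snd (U := U) (Finset.measurable_restrict _)
      (measurable_pi_apply n) hind)
  rw [Indep.setIntegral_eq_mul (history_le n) (X := fun z => z.1 n) hind'
    (by fun_prop) hC hφ.aestronglyMeasurable, mul_comm]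
  congr 1
  rw [← integral_map (by fun_prop) hφ.aestronglyMeasurable,
    (measurePreserving_sampleLaw P U n).map_eq]

/-- The two infinite products may be mutually singular, but events of `history n` ignore later
samples. There `Q` may be replaced by `P`, after which only finitely many factors differ and a
density exists. -/
theorem sampleLaw_eq_setLIntegral {φ : X → ℝ} (hφ : Measurable φ)
    (hPQ : Q = P.withDensity fun x => ENNReal.ofReal (Real.exp (-φ x))) {n : ℕ}
    {C : Set ((ℕ → X) × Ξ)} (hC : MeasurableSet[history X Ξ n] C) :
    sampleLaw Q U C = ∫⁻ z in C, ENNReal.ofReal (Real.exp (-∑ j ∈ Finset.range n, φ (z.1 j)))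
      ∂(sampleLaw P U) := by
  let R : ℕ → Measure X := fun k => if k ∈ Finset.range n then Q else P
  have hR : ∀ k, IsProbabilityMeasure (R k) := fun k => by
    simp only [R]; split_ifs <;> infer_instance
  have hdens := withDensity_infinitePi (fun _ => P) R (Finset.range n)
    (fun _ x => ENNReal.ofReal (Real.exp (-φ x))) (fun _ => by fun_prop)
    (fun k hk => by simp only [R, hk, if_true]; exact hPQ)
    (fun k hk => by simp only [R, hk, if_false])
  have hagree : (Measure.infinitePi R).prod U C = sampleLaw Q U C := by
    obtain ⟨C', hC', rfl⟩ := hC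
    rw [← Measure.map_apply (measurable_restrict_prodMk n) hC',
      ← Measure.map_apply (measurable_restrict_prodMk n) hC']
    have hmap : ∀ T : ℕ → Measure X, (∀ k, IsProbabilityMeasure (T k)) →
        ((Measure.infinitePi T).prod U).map
          (fun z => ((Finset.range n).restrict (π := fun _ => X) z.1, z.2))
        = (Measure.pi fun k : Finset.range n => T k).prod U := by
      intro T _
      rw [← Measure.infinitePi_map_restrict T]
      conv_rhs => rw [← Measure.map_id (μ := U)]
      rw [Measure.map_prod_map _ _ (Finset.measurable_restrict _) measurable_id]
      rfl
    unfold sampleLaw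
    rw [hmap R hR, hmap _ fun _ => inferInstance]
    congr 3
    ext k
    simp only [R, k.2, if_true]
  rw [← hagree, ← hdens, prod_withDensity_left (by fun_prop),
    withDensity_apply _ (history_le n _ hC)]
  refine lintegral_congr fun z => ?_
  rw [← Finset.sum_neg_distrib, Real.exp_sum,
    ENNReal.ofReal_prod_of_nonneg fun _ _ => (Real.exp_pos _).le]

end Samples

/-! ### Detectors as sequential tests -/

section Detectors

variable {s : ℕ} (f : Detector s)

/-- The event of terminating with decision `θ` after `k + 1` samples. -/
def Detector.acceptSet (θ : Bool) (k : ℕ) : Set ((ℕ → Fin s → ℝ) × (ℕ → I)) :=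
  {z | f.output z.1 z.2 k = .accept θ ∧ ∀ j < k, f.output z.1 z.2 j = .goOn}

/-- The event of taking more than `k` samples. -/
def Detector.goOnSet (k : ℕ) : Set ((ℕ → Fin s → ℝ) × (ℕ → I)) :=
  {z | ∀ j < k, f.output z.1 z.2 j = .goOn}

theorem Detector.measurableSet_output {k n : ℕ} (h : k < n) (d : Decision) :
    MeasurableSet[history (Fin s → ℝ) (ℕ → I) n] {z | f.output z.1 z.2 k = d} := by
  have hm : Measurable[history (Fin s → ℝ) (ℕ → I) n] fun z : (ℕ → Fin s → ℝ) × (ℕ → I) =>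
      ((fun j : Fin (k + 1) => z.1 j), fun j : Fin (k + 1) => z.2 j) := by
    refine Measurable.prodMk ?_ ?_
    · exact @measurable_pi_lambda _ _ _ (_) _ _ fun j =>
        measurable_history_apply ((Nat.lt_succ_iff.1 j.2).trans_lt h)
    · exact @measurable_pi_lambda _ _ _ (_) _ _ fun j =>
        (measurable_pi_apply (j : ℕ)).comp (measurable_history_snd n)
  exact hm (f.measurable_rule k d)

theorem Detector.measurableSet_goOnSet {k n : ℕ} (h : k ≤ n) :
    MeasurableSet[history (Fin s → ℝ) (ℕ → I) n] (f.goOnSet k) := by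
  have : f.goOnSet k = ⋂ j, ⋂ (_ : j < k), {z | f.output z.1 z.2 j = .goOn} := by
    ext; simp [Detector.goOnSet]
  rw [this]
  exact @MeasurableSet.iInter _ _ (_) _ _ fun j => @MeasurableSet.iInter _ _ (_) _ _ fun hj =>
    f.measurableSet_output (hj.trans_le h) _

theorem Detector.measurableSet_acceptSet (θ : Bool) (k : ℕ) :
    MeasurableSet[history (Fin s → ℝ) (ℕ → I) (k + 1)] (f.acceptSet θ k) :=
  @MeasurableSet.inter _ (_) _ _ (f.measurableSet_output k.lt_succ_self _)
    (f.measurableSet_goOnSet k.le_succ)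

/-- With `θ` the true state, `A` collects correct and `B` wrong decisions. A decision at index `k`
has used `k + 1` samples, whereas `goOnSet k` depends on the outputs before `k` only. -/
theorem Detector.stoppingSets (θ : Bool) :
    StoppingSets (history (Fin s → ℝ) (ℕ → I)) (f.acceptSet θ) (f.acceptSet !θ) f.goOnSet where
  measurable_left := f.measurableSet_acceptSet θ
  measurable_right := f.measurableSet_acceptSet !θ
  measurable_goOn _ := f.measurableSet_goOnSet le_rfl
  zero := by simp [Detector.goOnSet]
  eq_union k := by
    ext z
    simp only [Detector.goOnSet, Detector.acceptSet, Set.mem_ofPred_eq, Set.mem_union,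
      Nat.forall_lt_succ_right]
    cases f.output z.1 z.2 k with
    | goOn => simp
    | accept η => cases θ <;> cases η <;> simp
  disjoint_left_right k := Set.disjoint_left.2 fun z h h' => by
    have := h.1.symm.trans h'.1
    cases θ <;> simp at this
  disjoint_goOn k := Set.disjoint_left.2 fun z h h' => by
    have h'' := h' k k.lt_succ_self
    rcases h with h | h <;> simp [h.1] at h''

theorem Detector.setOf_decides (θ : Bool) :
    {z : (ℕ → Fin s → ℝ) × (ℕ → I) | f.Decides z.1 z.2 θ} = ⋃ k, f.acceptSet θ k := by
  ext; simp [Detector.Decides, Detector.acceptSet]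

/-- One half of the tail-sum formula for the sample number: if the output at `k` is a decision, `z`
lies in `goOnSet j` only for `j ≤ k`, that is for at most `k + 1` indices. Runs that never stop are
covered too. -/
theorem Detector.sum_indicator_goOnSet_le_stopTime (z : (ℕ → Fin s → ℝ) × (ℕ → I)) (n : ℕ) :
    ∑ k ∈ Finset.range n, (f.goOnSet k).indicator (fun _ => (1 : ℝ≥0∞)) z ≤ f.stopTime z.1 z.2 := by
  classical
  have hle : (((Finset.range n).filter fun k => z ∈ f.goOnSet k).card : ℕ∞)
      ≤ f.stopTime z.1 z.2 := by
    refine le_iInf₂ fun k hk => ?_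
    have hsub : ((Finset.range n).filter fun k => z ∈ f.goOnSet k) ⊆ Finset.range (k + 1) := by
      intro j hj
      rw [Finset.mem_range]
      by_contra hjk
      exact hk ((Finset.mem_filter.1 hj).2 k (by omega))
    exact_mod_cast (Finset.card_le_card hsub).trans_eq (Finset.card_range _)
  calc _ = (((Finset.range n).filter fun k => z ∈ f.goOnSet k).card : ℝ≥0∞) := by
        simp [Set.indicator_apply, Finset.sum_boole]
    _ ≤ _ := by exact_mod_cast ENat.toENNReal_le.2 hle

end Detectors


/-! ### The flip attack -/

/-- The sensors whose received observations depend on the state under the flip attack. -/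
def informativeSet (s c : ℕ) : Finset (Fin s) :=
  Finset.univ.filter fun i => c ≤ (i : ℕ) ∧ (i : ℕ) + c < s

theorem card_informativeSet {s c : ℕ} (hsc : 2 * c < s) :
    ((informativeSet s c).card : ℝ) = s - 2 * c := by
  have h : informativeSet s c = (flipSet s c false ∪ flipSet s c true)ᶜ := by
    ext i
    simp only [informativeSet, flipSet, Finset.mem_filter, Finset.mem_univ, true_and,
      Finset.mem_compl, Finset.mem_union]
    omega
  have hdisj : Disjoint (flipSet s c false) (flipSet s c true) := by
    rw [Finset.disjoint_left]
    intro i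
    simp only [flipSet, Finset.mem_filter, Finset.mem_univ, true_and]
    omega
  rw [h, Finset.card_compl, Finset.card_union_of_disjoint hdisj, card_flipSet hsc, card_flipSet hsc,
    Fintype.card_fin, Nat.cast_sub (by omega)]
  push_cast
  ring

theorem flippedLaw_of_notMem {s c : ℕ} (μ ν : Measure ℝ) {i : Fin s} (hi : i ∉ informativeSet s c)
    (θ η : Bool) :
    flippedLaw c μ ν θ i = flippedLaw c μ ν η i := by
  simp only [informativeSet, Finset.mem_filter, Finset.mem_univ, true_and] at hi
  unfold flippedLaw
  split_ifs <;> first | rfl | omega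

/-- One group of `c` corrupted sensors per state suffices: in state `0` the last sensors already
have law `ν` honestly, in state `1` the first ones already have law `μ`. -/
theorem flippedLaw_eq_ite {s c : ℕ} (μ ν : Measure ℝ) (hsc : 2 * c < s) (θ : Bool)
    (i : Fin s) :
    flippedLaw c μ ν θ i = if i ∈ flipSet s c θ then obsLaw μ ν (!θ) else obsLaw μ ν θ := by
  cases θ
  · simp [flippedLaw, flipSet, obsLaw]
  · by_cases h : (i : ℕ) < c
    · have : ¬ s ≤ (i : ℕ) + c := by omega
      simp [flippedLaw, flipSet, obsLaw, h, this]
    · simp [flippedLaw, flipSet, obsLaw, h]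

theorem flippedLaw_of_mem {s c : ℕ} (μ ν : Measure ℝ) {i : Fin s} (hi : i ∈ informativeSet s c)
    (θ : Bool) :
    flippedLaw c μ ν θ i = obsLaw μ ν θ := by
  have := (Finset.mem_filter.1 hi).2
  simp [flippedLaw, this.1.not_gt, this.2.not_ge]

section Flip

variable {s c : ℕ} (hsc : 2 * c < s) (μ ν : Measure ℝ) [IsProbabilityMeasure μ]
  [IsProbabilityMeasure ν]

theorem received_flipAttack (θ : Bool) (ω : Outcome s) :
    received (flipAttack hsc μ ν) θ ω
      = fun k i => if i ∈ flipSet s c θ then ω.2.1 k i else ω.1 k i := by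
  ext k i
  simp only [received, Pi.add_apply]
  rw [Attack.biasSeq]
  by_cases hi : i ∈ flipSet s c θ
  · simp [flipAttack, hi]
  · simp [flipAttack, hi]

/-- The joint law of the received observations and of the detector's randomisation under the flip
attack. -/
theorem map_received_prodMk_flipAttack (θ : Bool) :
    Measurable (fun ω : Outcome s => (received (flipAttack hsc μ ν) θ ω, ω.2.2)) ∧
    (prob μ ν (flipAttack hsc μ ν) θ).map
        (fun ω => (received (flipAttack hsc μ ν) θ ω, ω.2.2))
      = sampleLaw (Measure.pi fun i : Fin s => flippedLaw c μ ν θ i)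
          (Measure.infinitePi fun _ : ℕ => (volume : Measure I)) := by
  have hsel : Measurable fun (z : (ℕ → Fin s → ℝ) × (ℕ → Fin s → ℝ)) k i =>
      if i ∈ flipSet s c θ then z.2 k i else z.1 k i := by
    refine measurable_pi_lambda _ fun k => measurable_pi_lambda _ fun i => ?_
    split_ifs <;> fun_prop
  have hfun : (fun ω : Outcome s => (received (flipAttack hsc μ ν) θ ω, ω.2.2))
      = Prod.map (fun (z : (ℕ → Fin s → ℝ) × (ℕ → Fin s → ℝ)) k i =>
          if i ∈ flipSet s c θ then z.2 k i else z.1 k i) id ∘ MeasurableEquiv.prodAssoc.symm := by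
    ext1 ω
    rw [received_flipAttack]
    rfl
  have hmeas := (hsel.prodMap (measurable_id (α := ℕ → I))).comp
    (MeasurableEquiv.prodAssoc (α := ℕ → Fin s → ℝ) (β := ℕ → Fin s → ℝ)
      (γ := ℕ → I)).symm.measurable
  refine ⟨hfun ▸ hmeas, ?_⟩
  have hnoise : ((flipAttack hsc μ ν).noise θ : Measure (Fin s → ℝ))
      = Measure.pi fun _ => obsLaw μ ν !θ := rfl
  have hlaw := map_infinitePi_pi_prod_select (T := ℕ) (fun _ : Fin s => obsLaw μ ν θ)
    (fun _ => obsLaw μ ν !θ) (· ∈ flipSet s c θ)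
  simp only [← flippedLaw_eq_ite μ ν hsc] at hlaw
  rw [hfun, ← Measure.map_map (hsel.prodMap measurable_id) (MeasurableEquiv.measurable _), prob,
    hnoise, ← Measure.prodAssoc_prod, Measure.map_map (MeasurableEquiv.measurable _)
    (MeasurableEquiv.measurable _), MeasurableEquiv.symm_comp_self, Measure.map_id,
    ← Measure.map_prod_map _ _ hsel measurable_id, Measure.map_id, hlaw, sampleLaw]

theorem map_received_flipAttack (θ : Bool) :
    (prob μ ν (flipAttack hsc μ ν) θ).map (received (flipAttack hsc μ ν) θ) =
      Measure.infinitePi fun _ : ℕ => Measure.pi fun i : Fin s => flippedLaw c μ ν θ i := by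
  obtain ⟨hmeas, hmap⟩ := map_received_prodMk_flipAttack hsc μ ν θ
  have := congrArg (Measure.map Prod.fst) hmap
  rw [Measure.map_map measurable_fst hmeas, sampleLaw, Measure.map_fst_prod, measure_univ,
    one_smul] at this
  exact this

theorem prob_flipAttack_apply (θ : Bool) {C : Set ((ℕ → Fin s → ℝ) × (ℕ → I))}
    (hC : MeasurableSet C) :
    prob μ ν (flipAttack hsc μ ν) θ {ω | (received (flipAttack hsc μ ν) θ ω, ω.2.2) ∈ C}
      = sampleLaw (Measure.pi fun i : Fin s => flippedLaw c μ ν θ i)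
          (Measure.infinitePi fun _ : ℕ => (volume : Measure I)) C := by
  obtain ⟨hmeas, hmap⟩ := map_received_prodMk_flipAttack hsc μ ν θ
  rw [← hmap, Measure.map_apply hmeas hC]
  rfl

/-! ### Likelihood ratio and divergence of one received vector -/

/-- The log-likelihood ratio of one vector of received observations. -/
noncomputable def jointLLR (s c : ℕ) (p q : Measure ℝ) (x : Fin s → ℝ) : ℝ :=
  ∑ i ∈ informativeSet s c, llr p q (x i)

theorem measurable_jointLLR (p q : Measure ℝ) : Measurable (jointLLR s c p q) :=
  Finset.measurable_sum _ fun i _ => (measurable_llr p q).comp (measurable_pi_apply i)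

theorem withDensity_exp_neg_llr {p q : Measure ℝ} [IsProbabilityMeasure p] [IsProbabilityMeasure q]
    (hpq : p ≪ q) (hqp : q ≪ p) :
    q = p.withDensity fun x => ENNReal.ofReal (Real.exp (-llr p q x)) := by
  conv_lhs => rw [← Measure.withDensity_rnDeriv_eq q p hqp]
  refine withDensity_congr_ae ?_
  filter_upwards [exp_neg_llr hpq, q.rnDeriv_lt_top p] with x hx hlt
  have hx' : Real.exp (-llr p q x) = (q.rnDeriv p x).toReal := hx
  rw [hx', ENNReal.ofReal_toReal hlt.ne]

/-- Switching the state alters only the factors in `informativeSet`. The finite product is read as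
an `infinitePi` so that `withDensity_infinitePi` applies again. -/
theorem pi_flippedLaw_not (θ : Bool) (hpq : obsLaw μ ν θ ≪ obsLaw μ ν !θ)
    (hqp : obsLaw μ ν (!θ) ≪ obsLaw μ ν θ) :
    (Measure.pi fun i : Fin s => flippedLaw c μ ν (!θ) i)
      = (Measure.pi fun i : Fin s => flippedLaw c μ ν θ i).withDensity fun x =>
          ENNReal.ofReal (Real.exp (-jointLLR s c (obsLaw μ ν θ) (obsLaw μ ν !θ) x)) := by
  rw [← Measure.infinitePi_eq_pi, ← Measure.infinitePi_eq_pi,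
    ← withDensity_infinitePi _ _ (informativeSet s c)
      (fun _ x => ENNReal.ofReal (Real.exp (-llr (obsLaw μ ν θ) (obsLaw μ ν !θ) x)))
      (fun _ => ((measurable_llr _ _).neg.exp).ennreal_ofReal)
      (fun i hi => by
        simp only [flippedLaw_of_mem μ ν hi]
        exact withDensity_exp_neg_llr hpq hqp)
      (fun i hi => flippedLaw_of_notMem μ ν hi _ _)]
  congr 1
  ext x
  rw [jointLLR, ← Finset.sum_neg_distrib, Real.exp_sum,
    ENNReal.ofReal_prod_of_nonneg fun _ _ => (Real.exp_pos _).le]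

theorem measurePreserving_eval_pi_flippedLaw {i : Fin s} (hi : i ∈ informativeSet s c) (θ : Bool) :
    MeasurePreserving (fun x : Fin s → ℝ => x i)
      (Measure.pi fun i : Fin s => flippedLaw c μ ν θ i) (obsLaw μ ν θ) :=
  flippedLaw_of_mem μ ν hi θ ▸ measurePreserving_eval (fun i : Fin s => flippedLaw c μ ν θ i) i

theorem integrable_jointLLR {θ : Bool} {q : Measure ℝ}
    (hint : Integrable (llr (obsLaw μ ν θ) q) (obsLaw μ ν θ)) :
    Integrable (jointLLR s c (obsLaw μ ν θ) q)
      (Measure.pi fun i : Fin s => flippedLaw c μ ν θ i) :=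
  integrable_finsetSum _ fun _ hi =>
    (measurePreserving_eval_pi_flippedLaw μ ν hi θ).integrable_comp_of_integrable hint

theorem integral_jointLLR (hsc : 2 * c < s) {θ : Bool} {q : Measure ℝ}
    (hint : Integrable (llr (obsLaw μ ν θ) q) (obsLaw μ ν θ)) :
    ∫ x, jointLLR s c (obsLaw μ ν θ) q x ∂(Measure.pi fun i : Fin s => flippedLaw c μ ν θ i)
      = ((s : ℝ) - 2 * c) * ∫ x, llr (obsLaw μ ν θ) q x ∂(obsLaw μ ν θ) := by
  unfold jointLLR
  rw [integral_finsetSum (informativeSet s c) (f := fun i (x : Fin s → ℝ) => llr _ q (x i))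
    fun _ hi => (measurePreserving_eval_pi_flippedLaw μ ν hi θ).integrable_comp_of_integrable hint,
    ← card_informativeSet hsc, ← nsmul_eq_mul, ← Finset.sum_const]
  refine Finset.sum_congr rfl fun i hi => ?_
  have h := measurePreserving_eval_pi_flippedLaw μ ν hi θ
  rw [← integral_map h.measurable.aemeasurable
    (measurable_llr (obsLaw μ ν θ) q).aestronglyMeasurable, h.map_eq]

/-! ### Sample numbers and error probabilities under the flip attack -/

theorem sum_goOnSet_le_expectedSamples (f : Detector s) (θ : Bool) (n : ℕ) :
    ∑ k ∈ Finset.range n, sampleLaw (Measure.pi fun i : Fin s => flippedLaw c μ ν θ i)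
        (Measure.infinitePi fun _ : ℕ => (volume : Measure I)) (f.goOnSet k)
      ≤ expectedSamples μ ν f (flipAttack hsc μ ν) θ := by
  obtain ⟨hmeas, -⟩ := map_received_prodMk_flipAttack hsc μ ν θ
  have hG : ∀ k, MeasurableSet (f.goOnSet k) := fun k =>
    history_le k _ (f.measurableSet_goOnSet le_rfl)
  calc _ = ∑ k ∈ Finset.range n, ∫⁻ ω, (f.goOnSet k).indicator (fun _ => (1 : ℝ≥0∞))
        (received (flipAttack hsc μ ν) θ ω, ω.2.2) ∂(prob μ ν (flipAttack hsc μ ν) θ) :=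
        Finset.sum_congr rfl fun k _ => by
          rw [← prob_flipAttack_apply hsc μ ν θ (hG k)]
          exact (lintegral_indicator_one (hmeas (hG k))).symm
    _ = ∫⁻ ω, ∑ k ∈ Finset.range n, (f.goOnSet k).indicator (fun _ => (1 : ℝ≥0∞))
        (received (flipAttack hsc μ ν) θ ω, ω.2.2) ∂(prob μ ν (flipAttack hsc μ ν) θ) :=
        (lintegral_finsetSum _ fun k _ =>
          (measurable_const.indicator (hG k)).comp hmeas).symm
    _ ≤ _ := lintegral_mono fun ω => f.sum_indicator_goOnSet_le_stopTime _ n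

theorem measureReal_decides (f : Detector s) (θ η : Bool) :
    (prob μ ν (flipAttack hsc μ ν) θ).real
        {ω | f.Decides (received (flipAttack hsc μ ν) θ ω) ω.2.2 η}
      = (sampleLaw (Measure.pi fun i : Fin s => flippedLaw c μ ν θ i)
        (Measure.infinitePi fun _ : ℕ => (volume : Measure I))).real (⋃ k, f.acceptSet η k) := by
  rw [measureReal_def, measureReal_def, ← prob_flipAttack_apply hsc μ ν θ
    (.iUnion fun k => history_le _ _ (f.measurableSet_acceptSet η k)), ← f.setOf_decides]
  rfl

/-- Lower bound on the expected number of samples in state `θ` under the flip attack. -/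
theorem log_le_mul_delay_flipAttack {θ : Bool} (hpq : obsLaw μ ν θ ≪ obsLaw μ ν !θ)
    (hqp : obsLaw μ ν (!θ) ≪ obsLaw μ ν θ)
    (hint : Integrable (llr (obsLaw μ ν θ) (obsLaw μ ν !θ)) (obsLaw μ ν θ))
    (hpos : 0 ≤ ∫ x, llr (obsLaw μ ν θ) (obsLaw μ ν !θ) x ∂(obsLaw μ ν θ)) {f : Detector s} {ε : ℝ}
    (hε : 0 < ε) (h0 : typeI μ ν f (flipAttack hsc μ ν) = ε)
    (h1 : typeII μ ν f (flipAttack hsc μ ν) = ε) (hD : delay μ ν f (flipAttack hsc μ ν) ≠ ∞) :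
    Real.log (1 / ε) ≤
      ((s : ℝ) - 2 * c) * (∫ x, llr (obsLaw μ ν θ) (obsLaw μ ν !θ) x ∂(obsLaw μ ν θ))
        * (delay μ ν f (flipAttack hsc μ ν)).toReal + (2 * ε * Real.log (1 / ε) + 3 * ε) := by
  have herr : ∀ η : Bool, (sampleLaw (Measure.pi fun i : Fin s => flippedLaw c μ ν η i)
      (Measure.infinitePi fun _ : ℕ => (volume : Measure I))).real (⋃ k, f.acceptSet (!η) k)
        = ε := by
    intro η
    rw [← measureReal_decides hsc]
    cases η
    · exact h0
    · exact h1
  have hle : ∀ η : Bool, expectedSamples μ ν f (flipAttack hsc μ ν) η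
      ≤ delay μ ν f (flipAttack hsc μ ν) := by
    intro η
    cases η
    · exact le_max_left _ _
    · exact le_max_right _ _
  have hs : (0 : ℝ) ≤ s - 2 * c := card_informativeSet hsc ▸ Nat.cast_nonneg _
  have hmean := integral_jointLLR μ ν hsc hint
  refine (f.stoppingSets θ).log_le_mul history_le
    (P := sampleLaw (Measure.pi fun i : Fin s => flippedLaw c μ ν θ i)
      (Measure.infinitePi fun _ : ℕ => (volume : Measure I)))
    (Q := sampleLaw (Measure.pi fun i : Fin s => flippedLaw c μ ν (!θ) i)
      (Measure.infinitePi fun _ : ℕ => (volume : Measure I)))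
    (ℓ := fun k z => jointLLR s c (obsLaw μ ν θ) (obsLaw μ ν !θ) (z.1 k))
    (mul_nonneg hs hpos)
    (fun k => (measurable_jointLLR _ _).comp (by fun_prop))
    (fun k => (measurePreserving_sampleLaw _ _ k).integrable_comp_of_integrable
      (integrable_jointLLR μ ν hint))
    (fun k C hC => by
      rw [← hmean]
      exact setIntegral_sampleLaw _ (measurable_jointLLR _ _) hC)
    (fun n C hC => sampleLaw_eq_setLIntegral _ (measurable_jointLLR _ _)
      (pi_flippedLaw_not μ ν θ hpq hqp) hC)
    hε ((herr θ).symm.le.trans measureReal_le_one) (herr θ).le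
    -- In state `!θ` the wrong decision is `!!θ = θ`.
    (by simpa using (herr (!θ)).le) fun n => ?_
  simp only [measureReal_def]
  rw [← ENNReal.toReal_sum fun _ _ => measure_ne_top _ _]
  exact ENNReal.toReal_mono hD ((sum_goOnSet_le_expectedSamples hsc μ ν f θ n).trans (hle θ))

/-- At least one sample is always taken; this lets an additive error be absorbed into a multiple of
the delay. -/
theorem one_le_delay_flipAttack (f : Detector s) : 1 ≤ delay μ ν f (flipAttack hsc μ ν) := by
  refine le_trans ?_ ((sum_goOnSet_le_expectedSamples hsc μ ν f false 1).trans (le_max_left _ _))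
  simp [Detector.goOnSet]

end Flip

/-! ### From the bound at fixed error to the exponent -/

/-- An upper bound `log (1 / α) ≤ K * D + o(1)` on the error exponent bounds the performance. -/
theorem performance_le_of_log_le {s c : ℕ} {μ ν : Measure ℝ} [IsProbabilityMeasure μ]
    [IsProbabilityMeasure ν] {g : Attack s c} {ι : Type*} {f : ι → Detector s} {K : ℝ}
    (hK : 0 ≤ K) (hD1 : ∀ i, 1 ≤ delay μ ν (f i) g) {h : ℝ → ℝ}
    (hh : Tendsto h (𝓝[>] 0) (𝓝 0))
    (hle : ∀ i, ∀ ε > 0, typeI μ ν (f i) g = ε → typeII μ ν (f i) g = ε →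
      delay μ ν (f i) g ≠ ∞ → Real.log (1 / ε) ≤ K * (delay μ ν (f i) g).toReal + h ε) :
    performance μ ν f g ≤ ENNReal.ofReal K := by
  -- A trivial filter means no members with arbitrarily small equal errors; the upper limit is then
  -- `0`.
  rcases (errorFilter μ ν f g).eq_or_neBot with hbot | hne
  · rw [performance, hbot, limsup_bot]
    exact bot_le
  have hα : Tendsto (fun i => typeI μ ν (f i) g) (errorFilter μ ν f g) (𝓝[>] 0) :=
    tendsto_comap.mono_left inf_le_left
  have hlim : Tendsto (fun i => ENNReal.ofReal (K + |h (typeI μ ν (f i) g)|))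
      (errorFilter μ ν f g) (𝓝 (ENNReal.ofReal K)) := by
    have := ((hh.comp hα).abs.const_add K)
    simp only [abs_zero, add_zero] at this
    exact ENNReal.tendsto_ofReal this
  rw [performance, ← hlim.limsup_eq]
  refine limsup_le_limsup ?_
  have heq : ∀ᶠ i in errorFilter μ ν f g, typeI μ ν (f i) g = typeII μ ν (f i) g :=
    mem_inf_of_right (mem_principal_self _)
  filter_upwards [heq, hα self_mem_nhdsWithin] with i hi hpos
  -- With infinite delay the quotient is `0` in `ℝ≥0∞`.
  by_cases hD : delay μ ν (f i) g = ∞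
  · simp [hD]
  have hD1' : 1 ≤ (delay μ ν (f i) g).toReal := by
    simpa using ENNReal.toReal_mono hD (hD1 i)
  have hlog := hle i _ hpos rfl hi.symm hD
  refine ENNReal.div_le_of_le_mul ?_
  conv_rhs => rw [← ENNReal.ofReal_toReal hD]
  rw [← ENNReal.ofReal_mul (by positivity)]
  refine ENNReal.ofReal_le_ofReal (hlog.trans ?_)
  have := le_mul_of_one_le_right (abs_nonneg (h (typeI μ ν (f i) g))) hD1'
  linarith [le_abs_self (h (typeI μ ν (f i) g))]

theorem tendsto_error_term :
    Tendsto (fun ε : ℝ => 2 * ε * Real.log (1 / ε) + 3 * ε) (𝓝[>] 0) (𝓝 0) := by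
  -- `ε * log ε` is continuous at `0` with the convention `Real.log 0 = 0`.
  have h : Continuous fun ε : ℝ => -2 * (ε * Real.log ε) + 3 * ε := by
    have := Real.continuous_mul_log
    fun_prop
  have := (h.tendsto 0).mono_left (nhdsWithin_le_nhds (s := Set.Ioi 0))
  simp only [Real.log_zero, mul_zero, add_zero] at this
  refine this.congr fun ε => ?_
  rw [one_div, Real.log_inv]
  ring

end ByzantineDetection

theorem theorem1 (s c : ℕ) (hsc : 2 * c < s) (μ ν : Measure ℝ)
    [IsProbabilityMeasure μ] [IsProbabilityMeasure ν] (hμν : μ ≪ ν) (hνμ : ν ≪ μ)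
    (hint₁ : Integrable (llr μ ν) μ) (hint₀ : Integrable (llr μ ν) ν)
    (hI₁ : 0 < I₁ μ ν) (hI₀ : 0 < I₀ μ ν) :
    (∀ θ : Bool,
      (prob μ ν (flipAttack hsc μ ν) θ).map (received (flipAttack hsc μ ν) θ) =
        Measure.infinitePi fun _ : ℕ => Measure.pi fun i : Fin s => flippedLaw c μ ν θ i) ∧
    ∀ (ι : Type*) (f : ι → Detector s),
      performance μ ν f (flipAttack hsc μ ν) ≤
        ENNReal.ofReal (((s : ℝ) - 2 * c) * min (I₀ μ ν) (I₁ μ ν)) := by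
  refine ⟨map_received_flipAttack hsc μ ν, fun ι f => ?_⟩
  have hs : (0 : ℝ) ≤ s - 2 * c := card_informativeSet hsc ▸ Nat.cast_nonneg _
  -- The identity holds `μ`-almost everywhere and passes to `ν` by absolute continuity; it
  -- identifies `I₀` with the divergence of `ν` from `μ`.
  have hneg : (fun x => -llr μ ν x) =ᵐ[ν] llr ν μ := (hνμ.ae_eq (neg_llr hμν))
  have hI₀' : ∫ x, llr ν μ x ∂ν = I₀ μ ν := by
    rw [I₀, ← integral_neg]
    exact (integral_congr_ae hneg).symm
  refine performance_le_of_log_le (mul_nonneg hs (le_min hI₀.le hI₁.le))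
    (fun i => one_le_delay_flipAttack hsc μ ν (f i)) tendsto_error_term
    fun i ε hε h0 h1 hD => ?_
  -- The delay dominates the mean sample number in both states, so the bound is taken in the state
  -- whose divergence attains the minimum.
  rcases min_choice (I₀ μ ν) (I₁ μ ν) with h | h <;> rw [h]
  · have := log_le_mul_delay_flipAttack hsc μ ν (θ := false) hνμ hμν (hint₀.neg.congr hneg)
      (hI₀'.symm ▸ hI₀.le) hε h0 h1 hD
    rwa [← hI₀']
  · exact log_le_mul_delay_flipAttack hsc μ ν (θ := true) hμν hνμ hint₁ hI₁.le hε h0 h1 hD
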